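/- Let $X,Y\subset\mathbb{R}^n$ be closed convex sets with $X\cap Y\neq\emptyset$, $\operatorname{aff}(X)=\operatorname{aff}(Y)$ and $\operatorname{ri}(X)\cap\operatorname{ri}(Y)\neq\emptyset$. Let $P_X,P_Y$ be the metric projections onto $X$ and $Y$, let $R_X=2P_X-\mathrm{Id}$ and $R_Y=2P_Y-\mathrm{Id}$, and for $z\in\mathbb{R}^n$ put $$z_C=\tfrac12\bigl(P_YP_X(z)+P_X(P_YP_X(z))\bigr),\qquad T(z)=\operatorname{circum}\{z_C,R_X(z_C),R_Y(z_C)\},$$ where $\operatorname{circum}\{a,b,c\}$ is the point of the affine hull of $\{a,b,c\}$ that is equidistant from $a$, $b$ and $c$. Let $z^0\in\mathbb{R}^n$ be arbitrary and $z^{k+1}=T(z^k)$ for $k\ge 0$ (the centralized circumcentered-reflection method). Then the sequence $(z^k)$ is well defined (each circumcenter exists) and converges to some $\bar z\in X\cap Y$. If moreover the relative boundaries of $X$ and $Y$ are $\mathcal{C}^1$ manifolds of dimension $\dim\operatorname{aff}(X)-1$ near $\bar z$ within the common affine hull, then $(z^k)$ converges to $\bar z$ superlinearly, i.e. $$\|z^{k+1}-\bar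 z\|=o(\|z^k-\bar z\|)\quad(k\to\infty).$$ Here, for $C\subset\mathbb{R}^n$ closed and convex and $\bar z\in\operatorname{aff}(C)$, the relative boundary $\partial_{\operatorname{aff}(C)}C$ is a $\mathcal{C}^1$ manifold of dimension $\dim\operatorname{aff}(C)-1$ near $\bar z$ if $\dim\operatorname{aff}(C)\ge1$ and there are an open neighbourhood $U$ of $\bar z$ in $\operatorname{aff}(C)$ and a $\mathcal{C}^1$ function $g:U\to\mathbb{R}$ with $\partial_{\operatorname{aff}(C)}C\cap U=\{z\in U:g(z)=0\}$, $C\cap U=\{z\in U:g(z)\le0\}$, and nonzero gradient at $\bar z$ within $\operatorname{aff}(C)$. -/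

import Mathlib

open Filter Topology Asymptotics

namespace CCRM

section Definitions

variable {E : Type*} [NormedAddCommGroup E] [InnerProductSpace ℝ E]

/-- `p` is a point of `C` at minimal distance from `z`. -/
def IsNearestPoint (C : Set E) (z p : E) : Prop :=
  p ∈ C ∧ ∀ w ∈ C, dist z p ≤ dist z w

/-- The metric projection `P_C` onto `C`. For nonempty closed convex `C` in a finite-dimensional
space the nearest point exists and is unique, see `metricProj_eq_iff`. -/
noncomputable def metricProj (C : Set E) (z : E) : E :=
  Classical.epsilon (IsNearestPoint C z)

theorem IsNearestPoint.eq {C : Set E} (hC : Convex ℝ C) {z p q : E}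
    (hp : IsNearestPoint C z p) (hq : IsNearestPoint C z q) : p = q := by
  have hm : (1 / 2 : ℝ) • p + (1 / 2 : ℝ) • q ∈ C :=
    hC hp.1 hq.1 (by norm_num) (by norm_num) (by norm_num)
  have h1 := hp.2 _ hm
  have h2 : dist z p = dist z q := le_antisymm (hp.2 _ hq.1) (hq.2 _ hp.1)
  rw [dist_eq_norm, dist_eq_norm] at h1 h2
  have h3 := parallelogram_law_with_norm ℝ (z - p) (z - q)
  have h4 : (z - p) + (z - q) = (2 : ℝ) • (z - ((1 / 2 : ℝ) • p + (1 / 2 : ℝ) • q)) := by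
    module
  rw [h4, norm_smul, ← h2] at h3
  have h5 : (z - p) - (z - q) = q - p := by abel
  rw [h5] at h3
  norm_num at h3 h1
  have h6 : ‖q - p‖ * ‖q - p‖ ≤ 0 := by
    nlinarith [mul_self_le_mul_self (norm_nonneg (z - p)) h1]
  have h7 : ‖q - p‖ = 0 := by nlinarith [norm_nonneg (q - p)]
  exact (sub_eq_zero.mp (norm_eq_zero.mp h7)).symm

theorem metricProj_eq_iff [ProperSpace E] {C : Set E} (hcl : IsClosed C) (hC : Convex ℝ C)
    (hne : C.Nonempty) (z p : E) : metricProj C z = p ↔ IsNearestPoint C z p := by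
  have hex : ∃ q, IsNearestPoint C z q := by
    obtain ⟨q, hq, hd⟩ := hcl.exists_infDist_eq_dist hne z
    exact ⟨q, hq, fun w hw => hd ▸ Metric.infDist_le_dist_of_mem hw⟩
  have hs : IsNearestPoint C z (metricProj C z) := Classical.epsilon_spec hex
  exact ⟨fun h => h ▸ hs, fun h => hs.eq hC h⟩

/-- The reflection `R_C = 2 P_C - Id` through `C`. -/
noncomputable def reflect (C : Set E) (z : E) : E :=
  (2 : ℝ) • metricProj C z - z

/-- `p` is a circumcenter of the (possibly degenerate) triple `a, b, c`: it lies in the affine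
hull of `{a, b, c}` and is equidistant from the three points. -/
def IsCircumcenter (a b c p : E) : Prop :=
  p ∈ affineSpan ℝ ({a, b, c} : Set E) ∧ dist p a = dist p b ∧ dist p a = dist p c

theorem IsCircumcenter.eq {a b c p q : E} (hp : IsCircumcenter a b c p)
    (hq : IsCircumcenter a b c q) : p = q := by
  have key : ∀ x : E, dist p a = dist p x → dist q a = dist q x →
      inner ℝ (p - q) (x - a) = 0 := by
    intro x h1 h2
    rw [dist_eq_norm, dist_eq_norm] at h1 h2
    have e1 : ‖p - x‖ ^ 2 = ‖p - a‖ ^ 2 := by rw [h1]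
    have e2 : ‖q - x‖ ^ 2 = ‖q - a‖ ^ 2 := by rw [h2]
    have s1 : p - x = (p - a) - (x - a) := by abel
    have s2 : q - x = (q - a) - (x - a) := by abel
    rw [s1, norm_sub_sq_real] at e1
    rw [s2, norm_sub_sq_real] at e2
    have s3 : p - q = (p - a) - (q - a) := by abel
    rw [s3, inner_sub_left]
    linarith
  have hdir : p - q ∈ vectorSpan ℝ ({a, b, c} : Set E) := by
    have := AffineSubspace.vsub_mem_direction hp.1 hq.1
    rwa [direction_affineSpan, vsub_eq_sub] at this
  have hle : vectorSpan ℝ ({a, b, c} : Set E) ≤ (ℝ ∙ (p - q))ᗮ := by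
    rw [vectorSpan_eq_span_vsub_set_right ℝ (show a ∈ ({a, b, c} : Set E) by simp),
      Submodule.span_le]
    rintro _ ⟨x, hx, rfl⟩
    simp only [SetLike.mem_coe, vsub_eq_sub, Submodule.mem_orthogonal_singleton_iff_inner_right]
    rcases hx with rfl | rfl | rfl
    · simp
    · exact key _ hp.2.1 hq.2.1
    · exact key _ hp.2.2 hq.2.2
  have h0 := hle hdir
  rw [Submodule.mem_orthogonal_singleton_iff_inner_right, inner_self_eq_zero] at h0
  exact sub_eq_zero.mp h0

/-- The circumcenter of the triple `a, b, c`, which is unique when it exists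
(`IsCircumcenter.eq`). -/
noncomputable def circum (a b c : E) : E :=
  Classical.epsilon (IsCircumcenter a b c)

/-- The centralized point `z_C = (P_Y P_X z + P_X (P_Y P_X z)) / 2`. -/
noncomputable def centralized (X Y : Set E) (z : E) : E :=
  (1 / 2 : ℝ) • (metricProj Y (metricProj X z) + metricProj X (metricProj Y (metricProj X z)))

/-- The operator `T(z) = circum {z_C, R_X z_C, R_Y z_C}` of the centralized
circumcentered-reflection method. -/
noncomputable def cCRM (X Y : Set E) (z : E) : E :=
  circum (centralized X Y z) (reflect X (centralized X Y z)) (reflect Y (centralized X Y z))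

/-- Superlinear convergence of `w` to `l`: `w k → l` and `‖w (k+1) - l‖ / ‖w k - l‖ → 0`. The
second condition is written as a little-o relation, which is the limit of the quotient when
`w k ≠ l` for large `k`; if `w k = l` for some large `k`, it asks that `w (k+1) = l`. -/
def ConvergesSuperlinearly (w : ℕ → E) (l : E) : Prop :=
  Tendsto w atTop (𝓝 l) ∧ (fun k => ‖w (k + 1) - l‖) =o[atTop] (fun k => ‖w k - l‖)

end Definitions

section Boundary

variable {E : Type*} [NormedAddCommGroup E] [InnerProductSpace ℝ E] [FiniteDimensional ℝ E]

/-- The relative boundary of `C` is a `C^r` manifold of dimension `dim aff(C) - 1` near the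
point `zb` of `aff(C)`: `dim aff(C) ≥ 1` and, in a neighbourhood of `zb` in `aff(C)`, the relative
boundary is `{g = 0}` and `C` is `{g ≤ 0}`, for a `C^r` function `g` whose gradient within `aff(C)`
at `zb` does not vanish. The affine hull `aff(C) = zb + V` is parametrized by its direction `V`
through `v ↦ zb + v`, so that `zb` corresponds to `0`. -/
def HasCkRelBoundaryNear (r : WithTop ℕ∞) (C : Set E) (zb : E) : Prop :=
  zb ∈ affineSpan ℝ C ∧ 1 ≤ Module.finrank ℝ (affineSpan ℝ C).direction ∧
  ∃ (U : Set (affineSpan ℝ C).direction) (g : (affineSpan ℝ C).direction → ℝ),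
    IsOpen U ∧ 0 ∈ U ∧ ContDiffOn ℝ r g U ∧
    (∀ v ∈ U, zb + (v : E) ∈ intrinsicFrontier ℝ C ↔ g v = 0) ∧
    (∀ v ∈ U, zb + (v : E) ∈ C ↔ g v ≤ 0) ∧
    gradient g 0 ≠ 0

end Boundary

end CCRM

/-!
# Superlinear convergence of the centralized circumcentered-reflection method

Let `c = z_C`, `u = P_X c - c` and `v = P_Y c - c`. Since `c` is the midpoint of `q = P_Y P_X z` and
`P_X q`, it has the same projection onto `X` as `q`, and the obtuse-angle inequality for `P_Y c`
gives `⟪u, v⟫ ≤ 0` (`inner_metricProj_centralized_le_zero`). Consequently the point of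
`c + span {u, v}` on the two hyperplanes that support `X` and `Y` at `P_X c` and `P_Y c` is
`c + α u + β v` with `α, β ≥ 0`: it is the circumcenter `T z`, and at the same time the projection
of `c` onto the intersection of the two supporting half-spaces, which contains `X ∩ Y`
(`exists_nonneg_combination`, `cCRM_spec`). Hence the iterates are Fejér monotone with respect to
`X ∩ Y` and the steps `T z - c` tend to `0`; as these dominate the distances from `c` to `X` and to
`Y`, the sequence converges to a point `zb` of `X ∩ Y` (`exists_tendsto_of_cCRM`).

For the rate, Fejér monotonicity gives `‖z - zb‖ ≤ 2 dist(z, X ∩ Y)` for every iterate `z`, so it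
is enough to find a point of `X ∩ Y` at distance `o(‖z - zb‖)` from `T z`. The point `c` lies in
both sets or in neither of them (`centralized_mem_inter`). In the first case `T z = c ∈ X ∩ Y`. In
the second case `T z` lies on proper supporting hyperplanes of both sets. If `g` is a `C¹` defining
function of `X` near `zb`, with derivative `L` at `zb`, then strict differentiability shows that
`L` is small on these hyperplanes (`map_le_of_inner_normal_eq_zero`), so that
`g (T z) ≤ o(‖T z - P_X c‖) = o(‖z - zb‖)`. For a common relative interior point `e` the direction
`h = e - zb` satisfies `L h < 0`, for `X` and for `Y` alike (`map_interior_neg`), and therefore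
`T z + t h` lies in `X ∩ Y` for some `t = o(‖z - zb‖)`
(`exists_shift_mem_of_hasStrictFDerivAt`). Using one direction `h` for both sets replaces a
separate error bound for the pair `X`, `Y`. The argument takes place in the common affine hull,
which contains `c` and `T z`.
-/

namespace CCRM

/-! ### Metric projections -/

section Projection

variable {E : Type*} [NormedAddCommGroup E] [InnerProductSpace ℝ E]

theorem IsNearestPoint.inner_le_zero {C : Set E} (hC : Convex ℝ C) {z p s : E}
    (hp : IsNearestPoint C z p) (hs : s ∈ C) : inner ℝ (z - p) (s - p) ≤ 0 := by
  -- Compare `p` with the point `(1 - t) p + t s` of `C`; small `t` gives the claim.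
  have key : ∀ t : ℝ, 0 < t → t ≤ 1 → 2 * inner ℝ (z - p) (s - p) ≤ t * ‖s - p‖ ^ 2 := by
    intro t ht0 ht1
    have hm : (1 - t) • p + t • s ∈ C := hC hp.1 hs (by linarith) ht0.le (by ring)
    have h1 := hp.2 _ hm
    rw [dist_eq_norm, dist_eq_norm,
      show z - ((1 - t) • p + t • s) = (z - p) - t • (s - p) by module] at h1
    have h2 := pow_le_pow_left₀ (norm_nonneg _) h1 2
    rw [norm_sub_sq_real (z - p), inner_smul_right, norm_smul, mul_pow, Real.norm_eq_abs,
      sq_abs] at h2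
    have h3 : t * (2 * inner ℝ (z - p) (s - p)) ≤ t * (t * ‖s - p‖ ^ 2) := by nlinarith
    exact le_of_mul_le_mul_left h3 ht0
  by_contra! hpos
  have hsq : 0 ≤ ‖s - p‖ ^ 2 := sq_nonneg _
  set i := inner ℝ (z - p) (s - p) with hi
  have h1 := key (min 1 (i / (‖s - p‖ ^ 2 + 1))) (lt_min one_pos (by positivity)) (min_le_left _ _)
  have h2 : min 1 (i / (‖s - p‖ ^ 2 + 1)) * ‖s - p‖ ^ 2 ≤ i := by
    calc _ ≤ (i / (‖s - p‖ ^ 2 + 1)) * (‖s - p‖ ^ 2 + 1) := by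
          gcongr
          · exact min_le_right _ _
          · linarith
      _ = i := by field_simp
  linarith

theorem isNearestPoint_of_inner_le_zero {C : Set E} {z p : E} (hp : p ∈ C)
    (h : ∀ s ∈ C, inner ℝ (z - p) (s - p) ≤ 0) : IsNearestPoint C z p := by
  refine ⟨hp, fun s hs => ?_⟩
  rw [dist_eq_norm, dist_eq_norm, show z - s = (z - p) - (s - p) by abel]
  refine le_of_sq_le_sq ?_ (norm_nonneg _)
  rw [norm_sub_sq_real (z - p)]
  nlinarith [h s hs, sq_nonneg ‖s - p‖]

theorem IsNearestPoint.norm_sub_le {C : Set E} (hC : Convex ℝ C) {z p s : E}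
    (hp : IsNearestPoint C z p) (hs : s ∈ C) : ‖p - s‖ ≤ ‖z - s‖ := by
  refine le_of_sq_le_sq ?_ (norm_nonneg _)
  rw [show z - s = (z - p) - (s - p) by abel, norm_sub_sq_real (z - p), norm_sub_rev p s]
  nlinarith [hp.inner_le_zero hC hs, sq_nonneg ‖z - p‖]

variable [ProperSpace E]

theorem isNearestPoint_metricProj {C : Set E} (hcl : IsClosed C) (hC : Convex ℝ C)
    (hne : C.Nonempty) (z : E) : IsNearestPoint C z (metricProj C z) :=
  (metricProj_eq_iff hcl hC hne z _).1 rfl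

end Projection

/-! ### Circumcenters of reflected points -/

section Circumcenter

variable {E : Type*} [NormedAddCommGroup E] [InnerProductSpace ℝ E]

/-- The projection of the origin onto the intersection of the hyperplanes `⟪u, d⟫ = ‖u‖²` and
`⟪v, d⟫ = ‖v‖²` is a nonnegative combination of `u` and `v` when the angle between `u` and `v` is
not acute and the corresponding half-spaces have a common point `s`. The common point rules out
that `u` and `v` are nonzero and opposite, in which case the hyperplanes are disjoint. -/
theorem exists_nonneg_combination {u v s : E} (huv : inner ℝ u v ≤ 0)
    (hu : ‖u‖ ^ 2 ≤ inner ℝ u s) (hv : ‖v‖ ^ 2 ≤ inner ℝ v s) :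
    ∃ α β : ℝ, 0 ≤ α ∧ 0 ≤ β ∧ inner ℝ u (α • u + β • v) = ‖u‖ ^ 2 ∧
      inner ℝ v (α • u + β • v) = ‖v‖ ^ 2 := by
  rcases eq_or_ne u 0 with rfl | hu0
  · exact ⟨0, 1, le_rfl, zero_le_one, by simp, by simp⟩
  rcases eq_or_ne v 0 with rfl | hv0
  · exact ⟨1, 0, zero_le_one, le_rfl, by simp, by simp⟩
  have hpu : 0 < ‖u‖ ^ 2 := by positivity
  have hpv : 0 < ‖v‖ ^ 2 := by positivity
  have huu := real_inner_self_eq_norm_sq u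
  have hvv := real_inner_self_eq_norm_sq v
  have hvu := real_inner_comm u v
  set i := inner ℝ u v with hi
  have hnorm : ‖‖v‖ ^ 2 • u - i • v‖ ^ 2 = ‖v‖ ^ 2 * (‖u‖ ^ 2 * ‖v‖ ^ 2 - i ^ 2) := by
    rw [← real_inner_self_eq_norm_sq]
    simp only [inner_sub_left, inner_sub_right, real_inner_smul_left, inner_smul_right, huu, hvv,
      hvu, ← hi]
    ring
  -- If the Gram determinant vanished, `‖v‖² u` would equal `⟪u, v⟫ v`, and pairing with `s` would
  -- give a positive number on one side and a nonpositive one on the other.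
  have hdet : 0 < ‖u‖ ^ 2 * ‖v‖ ^ 2 - i ^ 2 := by
    have h0 : 0 ≤ ‖v‖ ^ 2 * (‖u‖ ^ 2 * ‖v‖ ^ 2 - i ^ 2) := hnorm ▸ sq_nonneg _
    refine lt_of_le_of_ne (nonneg_of_mul_nonneg_right h0 hpv) fun h => ?_
    rw [← h, mul_zero, sq_eq_zero_iff, norm_eq_zero] at hnorm
    have h1 : inner ℝ (‖v‖ ^ 2 • u - i • v) s = (0 : ℝ) := by rw [hnorm, inner_zero_left]
    rw [inner_sub_left, real_inner_smul_left, real_inner_smul_left] at h1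
    nlinarith [mul_le_mul_of_nonneg_left hu hpv.le, mul_pos hpu hpv,
      mul_nonneg_of_nonpos_of_nonpos huv (neg_nonpos.2 (hpv.le.trans hv))]
  -- Cramer's rule for the Gram system of `u` and `v`.
  refine ⟨‖v‖ ^ 2 * (‖u‖ ^ 2 - i) / (‖u‖ ^ 2 * ‖v‖ ^ 2 - i ^ 2),
    ‖u‖ ^ 2 * (‖v‖ ^ 2 - i) / (‖u‖ ^ 2 * ‖v‖ ^ 2 - i ^ 2),
    div_nonneg (mul_nonneg hpv.le (by linarith)) hdet.le,
    div_nonneg (mul_nonneg hpu.le (by linarith)) hdet.le, ?_, ?_⟩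
  · rw [inner_add_right, inner_smul_right, inner_smul_right, huu, ← hi, div_mul_eq_mul_div,
      div_mul_eq_mul_div, ← add_div, div_eq_iff hdet.ne']
    ring
  · rw [inner_add_right, inner_smul_right, inner_smul_right, hvv, hvu, div_mul_eq_mul_div,
      div_mul_eq_mul_div, ← add_div, div_eq_iff hdet.ne']
    ring

theorem dist_eq_dist_add_two_smul {c u d : E} (h : inner ℝ u d = ‖u‖ ^ 2) :
    dist (c + d) c = dist (c + d) (c + (2 : ℝ) • u) := by
  rw [dist_eq_norm, dist_eq_norm, add_sub_cancel_left, add_sub_add_left_eq_sub,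
    ← sq_eq_sq₀ (norm_nonneg _) (norm_nonneg _), norm_sub_sq_real, inner_smul_right,
    real_inner_comm, h, norm_smul]
  norm_num
  ring

theorem isCircumcenter_add {c u v : E} {α β : ℝ}
    (hu : inner ℝ u (α • u + β • v) = ‖u‖ ^ 2) (hv : inner ℝ v (α • u + β • v) = ‖v‖ ^ 2) :
    IsCircumcenter c (c + (2 : ℝ) • u) (c + (2 : ℝ) • v) (c + (α • u + β • v)) := by
  refine ⟨?_, dist_eq_dist_add_two_smul hu, dist_eq_dist_add_two_smul hv⟩
  have hc : c ∈ affineSpan ℝ ({c, c + (2 : ℝ) • u, c + (2 : ℝ) • v} : Set E) :=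
    subset_affineSpan ℝ _ (by simp)
  have hdir : ∀ w : E, c + (2 : ℝ) • w ∈ ({c, c + (2 : ℝ) • u, c + (2 : ℝ) • v} : Set E) →
      w ∈ (affineSpan ℝ ({c, c + (2 : ℝ) • u, c + (2 : ℝ) • v} : Set E)).direction := by
    intro w hw
    have h := AffineSubspace.vsub_mem_direction (subset_affineSpan ℝ _ hw) hc
    rw [vsub_eq_sub, add_sub_cancel_left] at h
    simpa using Submodule.smul_mem _ (1 / 2 : ℝ) h
  rw [add_comm c (α • u + β • v), ← vadd_eq_add (α • u + β • v) c]
  exact AffineSubspace.vadd_mem_of_mem_direction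
    (add_mem (Submodule.smul_mem _ _ (hdir u (by simp)))
      (Submodule.smul_mem _ _ (hdir v (by simp)))) hc

end Circumcenter

/-! ### The centralized circumcentered-reflection operator -/

section Operator

variable {E : Type*} [NormedAddCommGroup E] [InnerProductSpace ℝ E] [ProperSpace E] {X Y : Set E}

theorem norm_centralized_sub_le (hXcl : IsClosed X) (hX : Convex ℝ X) (hYcl : IsClosed Y)
    (hY : Convex ℝ Y) {s : E} (hs : s ∈ X ∩ Y) (z : E) : ‖centralized X Y z - s‖ ≤ ‖z - s‖ := by
  have h1 := (isNearestPoint_metricProj hXcl hX ⟨s, hs.1⟩ z).norm_sub_le hX hs.1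
  have h2 := (isNearestPoint_metricProj hYcl hY ⟨s, hs.2⟩ (metricProj X z)).norm_sub_le hY hs.2
  have h3 := (isNearestPoint_metricProj hXcl hX ⟨s, hs.1⟩
    (metricProj Y (metricProj X z))).norm_sub_le hX hs.1
  unfold centralized
  set q := metricProj Y (metricProj X z)
  set w := metricProj X q
  rw [show (1 / 2 : ℝ) • (q + w) - s = (1 / 2 : ℝ) • ((q - s) + (w - s)) by module, norm_smul]
  have := norm_add_le (q - s) (w - s)
  norm_num
  linarith

/-- The centralized point lies on the segment from `q = P_Y P_X z` to `P_X q`, so both have the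
same projection onto `X`. -/
theorem metricProj_centralized (hXcl : IsClosed X) (hX : Convex ℝ X) (hne : X.Nonempty) (z : E) :
    metricProj X (centralized X Y z) = metricProj X (metricProj Y (metricProj X z)) := by
  have h := isNearestPoint_metricProj hXcl hX hne (metricProj Y (metricProj X z))
  unfold centralized
  set q := metricProj Y (metricProj X z)
  set w := metricProj X q
  refine (metricProj_eq_iff hXcl hX hne _ _).2 (isNearestPoint_of_inner_le_zero h.1 fun s hs => ?_)
  rw [show (1 / 2 : ℝ) • (q + w) - w = (1 / 2 : ℝ) • (q - w) by module, real_inner_smul_left]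
  linarith [h.inner_le_zero hX hs]

/-- The displacements from the centralized point to its two projections form a non-acute angle. -/
theorem inner_metricProj_centralized_le_zero (hXcl : IsClosed X) (hX : Convex ℝ X)
    (hYcl : IsClosed Y) (hY : Convex ℝ Y) (hXY : (X ∩ Y).Nonempty) (z : E) :
    inner ℝ (metricProj X (centralized X Y z) - centralized X Y z)
      (metricProj Y (centralized X Y z) - centralized X Y z) ≤ 0 := by
  have hq := (isNearestPoint_metricProj hYcl hY hXY.right (metricProj X z)).1
  have h := (isNearestPoint_metricProj hYcl hY hXY.right
    (centralized X Y z)).inner_le_zero hY hq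
  rw [metricProj_centralized hXcl hX hXY.left]
  have hc : centralized X Y z = (1 / 2 : ℝ) • (metricProj Y (metricProj X z) +
    metricProj X (metricProj Y (metricProj X z))) := rfl
  set q := metricProj Y (metricProj X z)
  set w := metricProj X q
  set c := centralized X Y z
  set y := metricProj Y c
  have e1 : q - y = -((w - c) + (y - c)) := by rw [hc]; module
  have e2 : c - y = -(y - c) := by abel
  rw [e1, e2, inner_neg_neg, inner_add_right, real_inner_self_eq_norm_sq, real_inner_comm] at h
  linarith [sq_nonneg ‖y - c‖]

/-- The centralized point never lies in exactly one of the two sets. -/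
theorem centralized_mem_inter (hXcl : IsClosed X) (hX : Convex ℝ X) (hYcl : IsClosed Y)
    (hY : Convex ℝ Y) (hXY : (X ∩ Y).Nonempty) {z : E}
    (h : centralized X Y z ∈ X ∨ centralized X Y z ∈ Y) : centralized X Y z ∈ X ∩ Y := by
  have hp := isNearestPoint_metricProj hXcl hX hXY.left z
  have hq := isNearestPoint_metricProj hYcl hY hXY.right (metricProj X z)
  have hw := isNearestPoint_metricProj hXcl hX hXY.left (metricProj Y (metricProj X z))
  have hc : centralized X Y z = (1 / 2 : ℝ) • (metricProj Y (metricProj X z) +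
    metricProj X (metricProj Y (metricProj X z))) := rfl
  set p := metricProj X z
  set q := metricProj Y p
  set w := metricProj X q
  set c := centralized X Y z
  have hqw : ‖q - w‖ ^ 2 ≤ 0 := by
    rcases h with h | h
    · have h1 := hw.inner_le_zero hX h
      rw [show c - w = (1 / 2 : ℝ) • (q - w) by rw [hc]; module, inner_smul_right,
        real_inner_self_eq_norm_sq] at h1
      linarith
    · have h1 := hq.inner_le_zero hY h
      have h2 := hw.inner_le_zero hX hp.1
      rw [show c - q = -((1 / 2 : ℝ) • (q - w)) by rw [hc]; module, inner_neg_right,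
        inner_smul_right, show p - q = (p - w) - (q - w) by abel, inner_sub_left,
        real_inner_self_eq_norm_sq, real_inner_comm] at h1
      linarith
  have hqw' : q = w := by
    have : ‖q - w‖ = 0 := by nlinarith [norm_nonneg (q - w)]
    exact sub_eq_zero.1 (norm_eq_zero.1 this)
  have hcq : c = q := by rw [hc, ← hqw']; module
  rw [hcq]
  exact ⟨hqw' ▸ hw.1, hq.1⟩

/-- The circumcenter `T z` is the projection of `z_C` onto the intersection of the two half-spaces
that support `X` and `Y` at the projections of `z_C`. The statement collects what follows from
this: `T z` lies on both bounding hyperplanes, and the Pythagorean inequality holds for the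
points of `X ∩ Y`, which lie in both half-spaces. -/
theorem cCRM_spec (hXcl : IsClosed X) (hX : Convex ℝ X) (hYcl : IsClosed Y)
    (hY : Convex ℝ Y) (hXY : (X ∩ Y).Nonempty) (z : E) :
    IsCircumcenter (centralized X Y z) (reflect X (centralized X Y z))
      (reflect Y (centralized X Y z)) (cCRM X Y z) ∧
    inner ℝ (metricProj X (centralized X Y z) - centralized X Y z)
      (cCRM X Y z - centralized X Y z) =
        ‖metricProj X (centralized X Y z) - centralized X Y z‖ ^ 2 ∧
    inner ℝ (metricProj Y (centralized X Y z) - centralized X Y z)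
      (cCRM X Y z - centralized X Y z) =
        ‖metricProj Y (centralized X Y z) - centralized X Y z‖ ^ 2 ∧
    ∀ s ∈ X ∩ Y, ‖cCRM X Y z - s‖ ^ 2 + ‖cCRM X Y z - centralized X Y z‖ ^ 2 ≤
      ‖centralized X Y z - s‖ ^ 2 := by
  have huv := inner_metricProj_centralized_le_zero hXcl hX hYcl hY hXY z
  have hT : cCRM X Y z = Classical.epsilon (IsCircumcenter (centralized X Y z)
    (reflect X (centralized X Y z)) (reflect Y (centralized X Y z))) := rfl
  set c := centralized X Y z
  have hsupp : ∀ {C : Set E}, IsClosed C → Convex ℝ C → ∀ {s : E}, s ∈ C →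
      ‖metricProj C c - c‖ ^ 2 ≤ inner ℝ (metricProj C c - c) (s - c) := by
    intro C hcl hC s hs
    have h := (isNearestPoint_metricProj hcl hC ⟨s, hs⟩ c).inner_le_zero hC hs
    rw [show c - metricProj C c = -(metricProj C c - c) by abel,
      show s - metricProj C c = (s - c) - (metricProj C c - c) by abel, inner_neg_left,
      inner_sub_right, real_inner_self_eq_norm_sq] at h
    linarith
  have hsX := fun {s : E} (hs : s ∈ X) => hsupp hXcl hX hs
  have hsY := fun {s : E} (hs : s ∈ Y) => hsupp hYcl hY hs
  have hRX : reflect X c = c + (2 : ℝ) • (metricProj X c - c) := by unfold reflect; module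
  have hRY : reflect Y c = c + (2 : ℝ) • (metricProj Y c - c) := by unfold reflect; module
  rw [hRX, hRY] at hT ⊢
  set u := metricProj X c - c
  set v := metricProj Y c - c
  obtain ⟨s₀, hs₀⟩ := hXY
  obtain ⟨α, β, hα, hβ, h1, h2⟩ :=
    exists_nonneg_combination huv (hsX hs₀.1) (hsY hs₀.2)
  have hcirc := isCircumcenter_add (c := c) h1 h2
  have hTe : cCRM X Y z = c + (α • u + β • v) := by
    have hspec := Classical.epsilon_spec ⟨_, hcirc⟩
    rw [← hT] at hspec
    exact hspec.eq hcirc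
  rw [hTe, add_sub_cancel_left]
  refine ⟨hcirc, h1, h2, fun s hs => ?_⟩
  have h3 := hsX hs.1
  have h4 := hsY hs.2
  set d := α • u + β • v with hd
  have h5 : ‖d‖ ^ 2 ≤ inner ℝ d (s - c) := by
    have h6 : ‖d‖ ^ 2 = α * ‖u‖ ^ 2 + β * ‖v‖ ^ 2 := by
      rw [← real_inner_self_eq_norm_sq, ← h1, ← h2, ← real_inner_smul_left,
        ← real_inner_smul_left, ← inner_add_left]
    rw [h6]
    nth_rewrite 1 [hd]
    rw [inner_add_left, real_inner_smul_left, real_inner_smul_left]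
    gcongr
  rw [show c + d - s = d - (s - c) by abel, norm_sub_sq_real, norm_sub_rev c s]
  linarith

theorem cCRM_eq_centralized (hXcl : IsClosed X) (hX : Convex ℝ X) (hYcl : IsClosed Y)
    (hY : Convex ℝ Y) {z : E} (h : centralized X Y z ∈ X ∩ Y) :
    cCRM X Y z = centralized X Y z := by
  have h1 := (cCRM_spec hXcl hX hYcl hY ⟨_, h⟩ z).2.2.2 _ h
  rw [sub_self, norm_zero] at h1
  have : ‖cCRM X Y z - centralized X Y z‖ = 0 := by
    nlinarith [norm_nonneg (cCRM X Y z - centralized X Y z)]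
  exact sub_eq_zero.1 (norm_eq_zero.1 this)

theorem norm_cCRM_sub_le (hXcl : IsClosed X) (hX : Convex ℝ X) (hYcl : IsClosed Y)
    (hY : Convex ℝ Y) {s : E} (hs : s ∈ X ∩ Y) (z : E) : ‖cCRM X Y z - s‖ ≤ ‖z - s‖ := by
  refine le_trans (le_of_sq_le_sq ?_ (norm_nonneg _))
    (norm_centralized_sub_le hXcl hX hYcl hY hs z)
  linarith [(cCRM_spec hXcl hX hYcl hY ⟨s, hs⟩ z).2.2.2 s hs,
    sq_nonneg ‖cCRM X Y z - centralized X Y z‖]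

theorem centralized_mem_affineSpan (hXcl : IsClosed X) (hX : Convex ℝ X) (hYcl : IsClosed Y)
    (hY : Convex ℝ Y) (hXY : (X ∩ Y).Nonempty) (haff : affineSpan ℝ X = affineSpan ℝ Y) (z : E) :
    centralized X Y z ∈ affineSpan ℝ X := by
  have hq := subset_affineSpan ℝ Y
    (isNearestPoint_metricProj hYcl hY hXY.right (metricProj X z)).1
  have hw := subset_affineSpan ℝ X
    (isNearestPoint_metricProj hXcl hX hXY.left (metricProj Y (metricProj X z))).1
  rw [← haff] at hq
  have := (affineSpan ℝ X).convex hq hw (by norm_num : (0 : ℝ) ≤ 1 / 2)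
    (by norm_num : (0 : ℝ) ≤ 1 / 2) (by norm_num)
  rwa [← smul_add] at this

theorem cCRM_mem_affineSpan (hXcl : IsClosed X) (hX : Convex ℝ X) (hYcl : IsClosed Y)
    (hY : Convex ℝ Y) (hXY : (X ∩ Y).Nonempty) (haff : affineSpan ℝ X = affineSpan ℝ Y) (z : E) :
    cCRM X Y z ∈ affineSpan ℝ X := by
  have hc := centralized_mem_affineSpan hXcl hX hYcl hY hXY haff z
  refine affineSpan_le.2 ?_ (cCRM_spec hXcl hX hYcl hY hXY z).1.1
  have hR : ∀ {p : E}, p ∈ affineSpan ℝ X →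
      (2 : ℝ) • p - centralized X Y z ∈ affineSpan ℝ X := by
    intro p hp
    have := AffineMap.lineMap_mem (2 : ℝ) hc hp
    rw [AffineMap.lineMap_apply_module] at this
    convert this using 1
    module
  rintro x (rfl | rfl | rfl)
  · exact hc
  · exact hR (subset_affineSpan ℝ X (isNearestPoint_metricProj hXcl hX hXY.left _).1)
  · refine hR ?_
    rw [haff]
    exact subset_affineSpan ℝ Y (isNearestPoint_metricProj hYcl hY hXY.right _).1

end Operator


/-! ### Supporting hyperplanes of smooth convex bodies -/

section SmoothBoundary

/-- At a boundary point of a convex set described by `g ≤ 0`, the derivative of `g` is negative in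
the direction of every interior point. -/
theorem map_interior_neg {F : Type*} [NormedAddCommGroup F] [NormedSpace ℝ F] {D : Set F}
    (hD : Convex ℝ D) (h0 : (0 : F) ∈ D) {g : F → ℝ} {L : F →L[ℝ] ℝ}
    (hL : HasFDerivAt g L 0) (hL0 : L ≠ 0) (hg0 : g 0 = 0) (hg : ∀ᶠ v in 𝓝 0, v ∈ D → g v ≤ 0)
    {h : F} (hh : h ∈ interior D) : L h < 0 := by
  have hmax : IsLocalMaxOn g D 0 := by
    filter_upwards [nhdsWithin_le_nhds hg, self_mem_nhdsWithin] with v hv hvD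
    rw [hg0]
    exact hv hvD
  have hle : ∀ v ∈ D, L v ≤ 0 := fun v hv => by
    refine hmax.hasFDerivWithinAt_nonpos hL.hasFDerivWithinAt
      (mem_posTangentConeAt_of_segment_subset ?_)
    rw [zero_add]
    exact hD.segment_subset h0 hv
  obtain ⟨v, hv⟩ : ∃ v, 0 < L v := by
    obtain ⟨v, hv⟩ := DFunLike.ne_iff.1 hL0
    rcases lt_or_gt_of_ne hv with hv | hv
    · exact ⟨-v, by simpa using hv⟩
    · exact ⟨v, hv⟩
  -- Moving from `h` a little in a direction of increase of `L` does not leave `D`.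
  have hlim : Tendsto (fun s : ℝ => h + s • v) (𝓝[>] 0) (𝓝 h) := by
    have : Continuous fun s : ℝ => h + s • v := by fun_prop
    simpa using (this.tendsto 0).mono_left nhdsWithin_le_nhds
  obtain ⟨s, hs, hs0⟩ := ((hlim.eventually (mem_interior_iff_mem_nhds.1 hh)).and
    self_mem_nhdsWithin).exists
  have h1 := hle _ hs
  rw [map_add, map_smul, smul_eq_mul] at h1
  have h2 := mul_pos (Set.mem_Ioi.1 hs0) hv
  linarith

variable {F : Type*} [NormedAddCommGroup F] [InnerProductSpace ℝ F]

/-- If `m` is a nonzero normal at `y` to a set `{g ≤ 0}`, then a derivative `L` that approximates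
`g` up to `ε` near `y` is at most `ε ‖f‖` on vectors `f` orthogonal to `m`. Indeed a perturbation
of `-f` towards `m` points out of the set, so `g` cannot decrease along it. -/
theorem map_le_of_inner_normal_eq_zero {D : Set F} {g : F → ℝ} {L : F →L[ℝ] ℝ} {ε : ℝ}
    {y m f : F} (hgy : g y ≤ 0) (hD : ∀ᶠ v in 𝓝 y, g v ≤ 0 → v ∈ D)
    (hL : ∀ᶠ v in 𝓝 y, g v - g y - L (v - y) ≤ ε * ‖v - y‖)
    (hm0 : m ≠ 0) (hm : ∀ s ∈ D, inner ℝ m (s - y) ≤ 0) (hf : inner ℝ m f = 0) :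
    L f ≤ ε * ‖f‖ := by
  have key : ∀ ρ : ℝ, 0 < ρ → -(ε * ‖-f + ρ • m‖) ≤ L (-f + ρ • m) := by
    intro ρ hρ
    by_contra! hlt
    have hlim : Tendsto (fun t : ℝ => y + t • (-f + ρ • m)) (𝓝[>] 0) (𝓝 y) := by
      have : Continuous fun t : ℝ => y + t • (-f + ρ • m) := by fun_prop
      simpa using (this.tendsto 0).mono_left nhdsWithin_le_nhds
    obtain ⟨t, ⟨htD, htL⟩, ht⟩ := (((hlim.eventually hD).and (hlim.eventually hL)).and
      self_mem_nhdsWithin).exists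
    have ht : 0 < t := ht
    rw [add_sub_cancel_left, map_smul, smul_eq_mul, norm_smul, Real.norm_of_nonneg ht.le] at htL
    have h1 := hm _ (htD (by nlinarith))
    rw [add_sub_cancel_left, inner_smul_right, inner_add_right, inner_neg_right, hf,
      inner_smul_right, real_inner_self_eq_norm_sq] at h1
    have h2 : 0 < t * (-0 + ρ * ‖m‖ ^ 2) := by
      have := norm_pos_iff.2 hm0
      rw [neg_zero, zero_add]
      positivity
    linarith
  have hc1 : Continuous fun ρ : ℝ => -(ε * ‖-f + ρ • m‖) := by fun_prop
  have hc2 : Continuous fun ρ : ℝ => L (-f + ρ • m) := by fun_prop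
  have h := le_of_tendsto_of_tendsto ((hc1.tendsto 0).mono_left nhdsWithin_le_nhds)
    ((hc2.tendsto 0).mono_left nhdsWithin_le_nhds)
    (eventually_nhdsWithin_of_forall key : ∀ᶠ ρ in 𝓝[>] (0 : ℝ), _)
  simp only [zero_smul, add_zero, norm_neg, map_neg] at h
  linarith

/-- Near the point `0` of a smooth convex body `D`, a supporting hyperplane of `D` at `y` leaves
`D` only to first order: a point `x` of it is brought into `D` by a shift of length `o(‖x - y‖)`
along a fixed direction `h`, any interior point of `D`. -/
theorem exists_shift_mem_of_hasStrictFDerivAt {D : Set F} (hD : Convex ℝ D) (h0 : (0 : F) ∈ D)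
    {g : F → ℝ} {L : F →L[ℝ] ℝ} (hL : HasStrictFDerivAt g L 0) (hL0 : L ≠ 0)
    (hg : ∀ᶠ v in 𝓝 0, v ∈ D ↔ g v ≤ 0) {h : F} (hh : h ∈ interior D) {η : ℝ} (hη : 0 < η) :
    ∃ δ > 0, ∀ x y m : F, ‖x‖ < δ → ‖y‖ < δ → y ∈ D → m ≠ 0 →
      (∀ s ∈ D, inner ℝ m (s - y) ≤ 0) → inner ℝ m (x - y) = 0 →
      ∀ t, η * ‖x - y‖ ≤ t → t < δ → x + t • h ∈ D := by
  have hshift : ∀ {δ₀ : ℝ}, 0 < δ₀ → ∀ {x : F} {t : ℝ}, 0 ≤ t → ‖x‖ < δ₀ / (1 + ‖h‖) →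
      t < δ₀ / (1 + ‖h‖) → ‖x + t • h‖ < δ₀ := by
    intro δ₀ hδ₀ x t ht0 hx ht
    calc ‖x + t • h‖ ≤ ‖x‖ + t * ‖h‖ := by
          refine (norm_add_le _ _).trans_eq ?_
          rw [norm_smul, Real.norm_of_nonneg ht0]
      _ < δ₀ / (1 + ‖h‖) + δ₀ / (1 + ‖h‖) * ‖h‖ :=
          add_lt_add_of_lt_of_le hx (by gcongr)
      _ = δ₀ := by field_simp
  have hpos : ∀ {δ₀ : ℝ}, 0 < δ₀ → 0 < δ₀ / (1 + ‖h‖) := fun hδ₀ => by positivity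
  rcases (hg.self_of_nhds.1 h0).lt_or_eq with hg0 | hg0
  · -- Here `0` is an interior point of `D`.
    have hlt : ∀ᶠ v in 𝓝 0, g v < 0 := hL.continuousAt.eventually_lt_const hg0
    obtain ⟨δ₀, hδ₀, hball⟩ := Metric.eventually_nhds_iff.1 (hg.and hlt)
    refine ⟨δ₀ / (1 + ‖h‖), hpos hδ₀, fun x y m hx hy hyD hm0 hm hxy t ht htδ => ?_⟩
    have hd := hshift hδ₀ ((by positivity : (0 : ℝ) ≤ η * ‖x - y‖).trans ht) hx htδ
    obtain ⟨h1, h2⟩ := hball (by rwa [dist_zero_right] : dist (x + t • h) 0 < δ₀)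
    exact h1.2 h2.le
  have hneg := map_interior_neg hD h0 hL.hasFDerivAt hL0 hg0
    (hg.mono fun v hv => hv.1) hh
  -- At a boundary point, the decrease `t * l` of `g` along `t • h` outweighs the error
  -- `2 * ε * ‖x - y‖ + ε * t * ‖h‖` as soon as `η * ‖x - y‖ ≤ t`; `ε` is chosen to this end.
  set l := -L h with hl
  have hl0 : 0 < l := by linarith
  obtain ⟨ε, hε0, hε1, hε2⟩ : ∃ ε > 0, ε * ‖h‖ ≤ l / 2 ∧ 2 * ε ≤ η * (l / 2) := by
    refine ⟨min (l / 2 / (1 + ‖h‖)) (η * (l / 2) / 2), by positivity, ?_, ?_⟩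
    · calc _ ≤ l / 2 / (1 + ‖h‖) * (1 + ‖h‖) := by
            gcongr
            · exact min_le_left _ _
            · linarith
        _ = l / 2 := by field_simp
    · linarith [min_le_right (l / 2 / (1 + ‖h‖)) (η * (l / 2) / 2)]
  have hsm : ∀ᶠ p : F × F in 𝓝 (0, 0), g p.1 - g p.2 - L (p.1 - p.2) ≤ ε * ‖p.1 - p.2‖ :=
    (hL.isLittleO.bound hε0).mono fun p hp => (le_abs_self _).trans hp
  obtain ⟨δ₁, hδ₁, hb₁⟩ := Metric.eventually_nhds_iff.1 hsm
  obtain ⟨δ₂, hδ₂, hb₂⟩ := Metric.eventually_nhds_iff.1 hg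
  have hδ₀ : 0 < min δ₁ δ₂ := lt_min hδ₁ hδ₂
  have hsmall : ∀ {a b : F}, ‖a‖ < min δ₁ δ₂ → ‖b‖ < min δ₁ δ₂ →
      g a - g b - L (a - b) ≤ ε * ‖a - b‖ := by
    intro a b ha hb
    refine hb₁ (y := (a, b)) ?_
    rw [Prod.dist_eq, dist_zero_right, dist_zero_right]
    exact max_lt (ha.trans_le (min_le_left _ _)) (hb.trans_le (min_le_left _ _))
  have hmem : ∀ {a : F}, ‖a‖ < min δ₁ δ₂ → (a ∈ D ↔ g a ≤ 0) := fun {a} ha =>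
    hb₂ (by rw [dist_zero_right]; exact ha.trans_le (min_le_right _ _))
  refine ⟨min δ₁ δ₂ / (1 + ‖h‖), hpos hδ₀, fun x y m hx hy hyD hm0 hm hxy t ht htδ => ?_⟩
  have ht0 : 0 ≤ t := (by positivity : (0 : ℝ) ≤ η * ‖x - y‖).trans ht
  have hy' : ‖y‖ < min δ₁ δ₂ :=
    hy.trans_le (div_le_self hδ₀.le (by linarith [norm_nonneg h]))
  have hxt := hshift hδ₀ ht0 hx htδ
  have hnhds : ∀ᶠ v in 𝓝 y, ‖v‖ < min δ₁ δ₂ := continuous_norm.continuousAt.eventually_lt_const hy'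
  have hgy := (hmem hy').1 hyD
  have hLf := map_le_of_inner_normal_eq_zero hgy (hnhds.mono fun v hv => (hmem hv).2)
    (hnhds.mono fun v hv => hsmall hv hy') hm0 hm hxy
  have h1 := hsmall hxt hy'
  rw [hmem hxt]
  rw [show x + t • h - y = (x - y) + t • h by abel] at h1
  have h2 : ‖(x - y) + t • h‖ ≤ ‖x - y‖ + t * ‖h‖ := by
    refine (norm_add_le _ _).trans_eq ?_
    rw [norm_smul, Real.norm_of_nonneg ht0]
  rw [map_add, map_smul, smul_eq_mul] at h1
  have h3 := mul_le_mul_of_nonneg_left h2 hε0.le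
  have h4 := mul_le_mul_of_nonneg_left hε1 ht0
  have h5 := mul_le_mul_of_nonneg_right hε2 (norm_nonneg (x - y))
  have h6 := mul_le_mul_of_nonneg_right ht (by positivity : 0 ≤ l / 2)
  have h7 : L h = -l := by rw [hl, neg_neg]
  rw [h7] at h1
  nlinarith

/-- The estimate of `exists_shift_mem_of_hasStrictFDerivAt` in terms of the relative boundary, for
the hyperplane through the projection `y` of `c` with normal `c - y`. The set is read in the
direction of its affine hull, where a relative interior point becomes an interior point. -/
theorem HasCkRelBoundaryNear.exists_shift_mem {E : Type*} [NormedAddCommGroup E]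
    [InnerProductSpace ℝ E] [FiniteDimensional ℝ E] {C : Set E} {zb e : E}
    (hC : Convex ℝ C) (hzb : zb ∈ C) (he : e ∈ intrinsicInterior ℝ C)
    (hsm : HasCkRelBoundaryNear 1 C zb) {η : ℝ} (hη : 0 < η) :
    ∃ δ > 0, ∀ x c y : E, x ∈ affineSpan ℝ C → c ∈ affineSpan ℝ C → ‖x - zb‖ < δ →
      ‖y - zb‖ < δ → IsNearestPoint C c y → c ∉ C → inner ℝ (y - c) (x - y) = 0 →
      ∀ t, η * ‖x - y‖ ≤ t → t < δ → x + t • (e - zb) ∈ C := by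
  obtain ⟨hzA, -, U, g, hU, h0U, hgU, -, hgC, hgrad⟩ := hsm
  obtain ⟨e', he', rfl⟩ := mem_intrinsicInterior.1 he
  have hvec : ∀ {x y : E}, x ∈ affineSpan ℝ C → y ∈ affineSpan ℝ C →
      x - y ∈ (affineSpan ℝ C).direction := fun hx hy =>
    AffineSubspace.vsub_mem_direction hx hy
  let V : Submodule ℝ E := (affineSpan ℝ C).direction
  let D : Set V := {v | zb + (v : E) ∈ C}
  have hD : Convex ℝ D := by
    intro a ha b hb s t hs ht hst
    have := hC ha hb hs ht hst
    rw [smul_add, smul_add, add_add_add_comm, ← add_smul, hst, one_smul] at this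
    simpa [D] using this
  have h0 : (0 : V) ∈ D := by simpa [D] using hzb
  have hstrict : HasStrictFDerivAt g (fderiv ℝ g 0) 0 :=
    (hgU.contDiffAt (hU.mem_nhds h0U)).hasStrictFDerivAt one_ne_zero
  have hL0 : fderiv ℝ g 0 ≠ 0 := fun h => hgrad (by rw [gradient, h, map_zero])
  have hh : (⟨e' - zb, hvec e'.2 hzA⟩ : V) ∈ interior D := by
    rw [mem_interior_iff_mem_nhds] at he' ⊢
    let φ : V → affineSpan ℝ C := fun v =>
      ⟨v + zb, AffineSubspace.vadd_mem_of_mem_direction v.2 hzA⟩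
    have hφ : Continuous φ := by
      refine Continuous.subtype_mk ?_ _
      fun_prop
    have hφe : φ ⟨e' - zb, hvec e'.2 hzA⟩ = e' := Subtype.ext (sub_add_cancel _ _)
    have := hφ.continuousAt.preimage_mem_nhds (hφe.symm ▸ he')
    refine mem_of_superset this fun v hv => ?_
    change zb + (v : E) ∈ C
    rw [add_comm]
    exact hv
  obtain ⟨δ, hδ, H⟩ := exists_shift_mem_of_hasStrictFDerivAt hD h0 hstrict hL0
    (mem_of_superset (hU.mem_nhds h0U) hgC) hh hη
  refine ⟨δ, hδ, fun x c y hx hc hxδ hyδ hy hcC hxy t ht htδ => ?_⟩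
  have hyA := subset_affineSpan ℝ C hy.1
  have hmem := H ⟨x - zb, hvec hx hzA⟩ ⟨y - zb, hvec hyA hzA⟩ ⟨c - y, hvec hc hyA⟩ hxδ hyδ
    (by simpa [D] using hy.1)
    (fun h => hcC (sub_eq_zero.1 (congrArg Subtype.val h) ▸ hy.1))
    (fun s hs => by
      have := hy.inner_le_zero hC hs
      rwa [show zb + (s : E) - y = s - (y - zb) by abel] at this)
    (by
      rw [← neg_sub c y, inner_neg_left, neg_eq_zero] at hxy
      change inner ℝ (c - y) ((x - zb) - (y - zb)) = 0
      rwa [sub_sub_sub_cancel_right])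
    t (by
      change η * ‖(x - zb) - (y - zb)‖ ≤ t
      rwa [sub_sub_sub_cancel_right]) htδ
  have : zb + ((x - zb) + t • ((e' : E) - zb)) ∈ C := hmem
  rwa [← add_assoc, add_sub_cancel] at this

end SmoothBoundary


/-! ### Convergence of the iterates -/

section Convergence

variable {E : Type*} [NormedAddCommGroup E] [InnerProductSpace ℝ E] [FiniteDimensional ℝ E]
  {X Y : Set E} {z : ℕ → E}

theorem exists_tendsto_of_cCRM (hXcl : IsClosed X) (hX : Convex ℝ X) (hYcl : IsClosed Y)
    (hY : Convex ℝ Y) (hXY : (X ∩ Y).Nonempty) (hz : ∀ k, z (k + 1) = cCRM X Y (z k)) :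
    ∃ zb ∈ X ∩ Y, Tendsto z atTop (𝓝 zb) := by
  have hF : ∀ s ∈ X ∩ Y, Antitone fun k => ‖z k - s‖ := fun s hs =>
    antitone_nat_of_succ_le fun k => hz k ▸ norm_cCRM_sub_le hXcl hX hYcl hY hs _
  obtain ⟨s, hs⟩ := hXY
  -- The distances to `s` converge, so the Pythagorean inequality forces the steps to vanish.
  have hlim := tendsto_atTop_ciInf (hF s hs) ⟨0, by rintro _ ⟨k, rfl⟩; exact norm_nonneg _⟩
  have hstep : Tendsto (fun k => z (k + 1) - centralized X Y (z k)) atTop (𝓝 0) := by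
    have h1 : Tendsto (fun k => ‖z k - s‖ ^ 2 - ‖z (k + 1) - s‖ ^ 2) atTop (𝓝 0) := by
      simpa using (hlim.pow 2).sub ((hlim.comp (tendsto_add_atTop_nat 1)).pow 2)
    have h2 : Tendsto (fun k => ‖z (k + 1) - centralized X Y (z k)‖ ^ 2) atTop (𝓝 0) := by
      refine squeeze_zero (fun k => sq_nonneg _) (fun k => ?_) h1
      have h3 := (cCRM_spec hXcl hX hYcl hY ⟨s, hs⟩ (z k)).2.2.2 s hs
      have h4 := pow_le_pow_left₀ (norm_nonneg _)
        (norm_centralized_sub_le hXcl hX hYcl hY hs (z k)) 2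
      rw [hz k]
      linarith
    rw [tendsto_zero_iff_norm_tendsto_zero]
    simpa using h2.sqrt
  have hproj : ∀ {u d : E}, inner ℝ u d = ‖u‖ ^ 2 → ‖u‖ ≤ ‖d‖ := by
    intro u d h
    rcases (norm_nonneg u).eq_or_lt with h0 | h0
    · rw [← h0]
      exact norm_nonneg d
    · have := real_inner_le_norm u d
      rw [h, sq] at this
      exact le_of_mul_le_mul_left this h0
  have hstepX : Tendsto (fun k => metricProj X (centralized X Y (z k)) - centralized X Y (z k))
      atTop (𝓝 0) :=
    squeeze_zero_norm (fun k => by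
      have := hproj (cCRM_spec hXcl hX hYcl hY ⟨s, hs⟩ (z k)).2.1
      rwa [← hz k] at this) (tendsto_zero_iff_norm_tendsto_zero.1 hstep)
  have hstepY : Tendsto (fun k => metricProj Y (centralized X Y (z k)) - centralized X Y (z k))
      atTop (𝓝 0) :=
    squeeze_zero_norm (fun k => by
      have := hproj (cCRM_spec hXcl hX hYcl hY ⟨s, hs⟩ (z k)).2.2.1
      rwa [← hz k] at this) (tendsto_zero_iff_norm_tendsto_zero.1 hstep)
  obtain ⟨zb, -, φ, hφ, hzb⟩ := (isCompact_closedBall s ‖z 0 - s‖).tendsto_subseq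
    (x := fun k => z (k + 1)) fun k => by
      rw [mem_closedBall_iff_norm]
      exact hF s hs (Nat.zero_le _)
  have hφt := hφ.tendsto_atTop
  have hc : Tendsto (fun k => centralized X Y (z (φ k))) atTop (𝓝 zb) := by
    simpa using hzb.sub (hstep.comp hφt)
  have hmemX : zb ∈ X := hXcl.mem_of_tendsto
    (by simpa using (hstepX.comp hφt).add hc)
    (Eventually.of_forall fun k => (isNearestPoint_metricProj hXcl hX ⟨s, hs.1⟩ _).1)
  have hmemY : zb ∈ Y := hYcl.mem_of_tendsto
    (by simpa using (hstepY.comp hφt).add hc)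
    (Eventually.of_forall fun k => (isNearestPoint_metricProj hYcl hY ⟨s, hs.2⟩ _).1)
  refine ⟨zb, ⟨hmemX, hmemY⟩, ?_⟩
  rw [Metric.tendsto_atTop]
  intro ε hε
  obtain ⟨k, hk⟩ := (Metric.tendsto_nhds.1 hzb ε hε).exists
  refine ⟨φ k + 1, fun n hn => ?_⟩
  rw [dist_eq_norm]
  refine lt_of_le_of_lt (hF zb ⟨hmemX, hmemY⟩ hn) ?_
  simpa [dist_eq_norm] using hk

/-- The limit of the iterates is at most twice as far from an iterate as any common point. -/
theorem norm_sub_limit_le (hXcl : IsClosed X) (hX : Convex ℝ X) (hYcl : IsClosed Y)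
    (hY : Convex ℝ Y) (hz : ∀ k, z (k + 1) = cCRM X Y (z k)) {zb s : E}
    (hlim : Tendsto z atTop (𝓝 zb)) (hs : s ∈ X ∩ Y) (k : ℕ) :
    ‖z k - zb‖ ≤ 2 * ‖z k - s‖ := by
  have hF : Antitone fun k => ‖z k - s‖ :=
    antitone_nat_of_succ_le fun k => hz k ▸ norm_cCRM_sub_le hXcl hX hYcl hY hs _
  have h1 : ‖zb - s‖ ≤ ‖z k - s‖ := hF.le_of_tendsto (hlim.sub_const s).norm k
  have h2 := norm_sub_le_norm_sub_add_norm_sub (z k) s zb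
  rw [norm_sub_rev s zb] at h2
  linarith

theorem convergesSuperlinearly_of_cCRM (hXcl : IsClosed X) (hX : Convex ℝ X) (hYcl : IsClosed Y)
    (hY : Convex ℝ Y) (haff : affineSpan ℝ X = affineSpan ℝ Y)
    (hri : (intrinsicInterior ℝ X ∩ intrinsicInterior ℝ Y).Nonempty)
    (hz : ∀ k, z (k + 1) = cCRM X Y (z k)) {zb : E} (hzb : zb ∈ X ∩ Y)
    (hlim : Tendsto z atTop (𝓝 zb)) (hsX : HasCkRelBoundaryNear 1 X zb)
    (hsY : HasCkRelBoundaryNear 1 Y zb) : ConvergesSuperlinearly z zb := by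
  refine ⟨hlim, ?_⟩
  obtain ⟨e, heX, heY⟩ := hri
  rw [isLittleO_iff]
  intro ε hε
  obtain ⟨κ, hκ, hκε⟩ : ∃ κ > 0, 2 * (κ * ‖e - zb‖) ≤ ε := by
    refine ⟨ε / 2 / (1 + ‖e - zb‖), by positivity, ?_⟩
    calc _ ≤ 2 * (ε / 2 / (1 + ‖e - zb‖) * (1 + ‖e - zb‖)) := by
          gcongr
          linarith
      _ = ε := by field_simp
  obtain ⟨δX, hδX, HX⟩ := hsX.exists_shift_mem hX hzb.1 heX (half_pos hκ)
  obtain ⟨δY, hδY, HY⟩ := hsY.exists_shift_mem hY hzb.2 heY (half_pos hκ)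
  have hnorm : Tendsto (fun k => ‖z k - zb‖) atTop (𝓝 0) := by
    simpa using (hlim.sub_const zb).norm
  have hsmall : ∀ᶠ k in atTop, ‖z k - zb‖ < min δX δY ∧ κ * ‖z k - zb‖ < min δX δY := by
    refine (hnorm.eventually_lt_const (lt_min hδX hδY)).and ?_
    have : Tendsto (fun k => κ * ‖z k - zb‖) atTop (𝓝 0) := by simpa using hnorm.const_mul κ
    exact this.eventually_lt_const (lt_min hδX hδY)
  filter_upwards [hsmall] with k hk
  rw [norm_norm, norm_norm]
  -- A common point of `X` and `Y` close to `z (k + 1)` suffices.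
  suffices h : ∃ s ∈ X ∩ Y, ‖z (k + 1) - s‖ ≤ κ * ‖e - zb‖ * ‖z k - zb‖ by
    obtain ⟨s, hs, hle⟩ := h
    calc ‖z (k + 1) - zb‖ ≤ 2 * ‖z (k + 1) - s‖ :=
          norm_sub_limit_le hXcl hX hYcl hY hz hlim hs _
      _ ≤ 2 * (κ * ‖e - zb‖) * ‖z k - zb‖ := by linarith
      _ ≤ ε * ‖z k - zb‖ := by gcongr
  by_cases hc : centralized X Y (z k) ∈ X ∩ Y
  · refine ⟨z (k + 1), ?_, ?_⟩
    · rwa [hz k, cCRM_eq_centralized hXcl hX hYcl hY hc]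
    · rw [sub_self, norm_zero]
      positivity
  have hcX : centralized X Y (z k) ∉ X := fun h =>
    hc (centralized_mem_inter hXcl hX hYcl hY ⟨zb, hzb⟩ (Or.inl h))
  have hcY : centralized X Y (z k) ∉ Y := fun h =>
    hc (centralized_mem_inter hXcl hX hYcl hY ⟨zb, hzb⟩ (Or.inr h))
  have hcA := centralized_mem_affineSpan hXcl hX hYcl hY ⟨zb, hzb⟩ haff (z k)
  have hzA := cCRM_mem_affineSpan hXcl hX hYcl hY ⟨zb, hzb⟩ haff (z k)
  obtain ⟨-, hinX, hinY, -⟩ := cCRM_spec hXcl hX hYcl hY ⟨zb, hzb⟩ (z k)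
  have hx := norm_cCRM_sub_le hXcl hX hYcl hY hzb (z k)
  have hcz := norm_centralized_sub_le hXcl hX hYcl hY hzb (z k)
  rw [← hz k] at hzA hinX hinY hx
  set c := centralized X Y (z k)
  have hpX := isNearestPoint_metricProj hXcl hX ⟨zb, hzb.1⟩ c
  have hpY := isNearestPoint_metricProj hYcl hY ⟨zb, hzb.2⟩ c
  -- The equality `⟪u, T z - c⟫ = ‖u‖²` for `u = p - c` says that `T z` lies on the hyperplane
  -- through `p` orthogonal to `u`.
  have hplane : ∀ {p x : E}, inner ℝ (p - c) (x - c) = ‖p - c‖ ^ 2 →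
      inner ℝ (p - c) (x - p) = 0 := by
    intro p x h
    rw [show x - p = (x - c) - (p - c) by abel, inner_sub_right, h, real_inner_self_eq_norm_sq,
      sub_self]
  have hdist : ∀ {p : E}, ‖p - zb‖ ≤ ‖c - zb‖ →
      κ / 2 * ‖z (k + 1) - p‖ ≤ κ * ‖z k - zb‖ := by
    intro p hp
    have h1 := norm_sub_le_norm_sub_add_norm_sub (z (k + 1)) zb p
    rw [norm_sub_rev zb p] at h1
    calc κ / 2 * ‖z (k + 1) - p‖ ≤ κ / 2 * (2 * ‖z k - zb‖) := by gcongr; linarith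
      _ = κ * ‖z k - zb‖ := by ring
  have hpX' := hpX.norm_sub_le hX hzb.1
  have hpY' := hpY.norm_sub_le hY hzb.2
  have hltX := hk.1.trans_le (min_le_left δX δY)
  have hltY := hk.1.trans_le (min_le_right δX δY)
  refine ⟨z (k + 1) + (κ * ‖z k - zb‖) • (e - zb), ⟨?_, ?_⟩, ?_⟩
  · exact HX _ c _ hzA hcA (hx.trans_lt hltX) ((hpX'.trans hcz).trans_lt hltX) hpX hcX
      (hplane hinX) _ (hdist hpX') (hk.2.trans_le (min_le_left _ _))
  · exact HY _ c _ (haff ▸ hzA) (haff ▸ hcA) (hx.trans_lt hltY)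
      ((hpY'.trans hcz).trans_lt hltY) hpY hcY
      (hplane hinY) _ (hdist hpY') (hk.2.trans_le (min_le_right _ _))
  · rw [sub_add_cancel_left, norm_neg, norm_smul, Real.norm_of_nonneg (by positivity)]
    exact le_of_eq (by ring)

end Convergence

end CCRM

theorem mainTheorem2 {n : ℕ} (X Y : Set (EuclideanSpace ℝ (Fin n)))
    (hXclosed : IsClosed X) (hXconvex : Convex ℝ X)
    (hYclosed : IsClosed Y) (hYconvex : Convex ℝ Y)
    (hXY : (X ∩ Y).Nonempty)
    (haff : affineSpan ℝ X = affineSpan ℝ Y)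
    (hri : (intrinsicInterior ℝ X ∩ intrinsicInterior ℝ Y).Nonempty)
    (z : ℕ → EuclideanSpace ℝ (Fin n))
    (hz : ∀ k, z (k + 1) = CCRM.cCRM X Y (z k)) :
    (∀ k, CCRM.IsCircumcenter (CCRM.centralized X Y (z k))
      (CCRM.reflect X (CCRM.centralized X Y (z k)))
      (CCRM.reflect Y (CCRM.centralized X Y (z k))) (z (k + 1))) ∧
    ∃ zb ∈ X ∩ Y, Tendsto z atTop (𝓝 zb) ∧
      (CCRM.HasCkRelBoundaryNear 1 X zb → CCRM.HasCkRelBoundaryNear 1 Y zb →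
        CCRM.ConvergesSuperlinearly z zb) := by
  obtain ⟨zb, hzb, hlim⟩ :=
    CCRM.exists_tendsto_of_cCRM hXclosed hXconvex hYclosed hYconvex hXY hz
  exact ⟨fun k => hz k ▸ (CCRM.cCRM_spec hXclosed hXconvex hYclosed hYconvex hXY (z k)).1,
    zb, hzb, hlim, CCRM.convergesSuperlinearly_of_cCRM hXclosed hXconvex hYclosed hYconvex haff
      hri hz hzb hlim⟩
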